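/- Let $L$ be a relational language (with arbitrarily many relation symbols, each of finite arity) containing a distinguished binary relation symbol $\leq$. An $L$-structure $\mathbf{M}$ with vertex set $M$ is called \emph{ordered} if the interpretation $\leq_{\mathbf{M}}$ is a linear order on $M$. For $L$-structures $\mathbf{A}, \mathbf{B}$, let $\mathrm{Emb}(\mathbf{A},\mathbf{B})$ be the set of embeddings $\mathbf{A}\to\mathbf{B}$, that is, injective maps that preserve every relation of $L$ in both directions. For $L$-structures $\mathbf{A},\mathbf{B},\mathbf{C}$, write $\mathbf{C}\longrightarrow(\mathbf{B})^{\mathbf{A}}_2$ if for every colouring $\chi\colon \mathrm{Emb}(\mathbf{A},\mathbf{C})\to\{0,1\}$ there exists $f\in \mathrm{Emb}(\mathbf{B},\mathbf{C})$ such that $\chi$ is constant on $\{f\circ g : g\in\mathrm{Emb}(\mathbf{A},\mathbf{B})\}$. \textbf{Theorem} (Ne\v{s}et\v{r}il--R\"odl, Abramson--Harrington, unrestricted form). Let $\mathbf{A}$ and $\mathbf{B}$ be finite ordered $L$-structures. Then there exists a finite ordered $L$-structure $\mathbf{C}$ such that $\mathbf{C}\longrightarrow(\mathbf{B})^{\mathbf{A}}_2$.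 -/

import Mathlib

open scoped FirstOrder

namespace StructuralRamsey

open FirstOrder FirstOrder.Language FirstOrder.Language.Structure

/-- For a language `L` with a distinguished binary relation symbol `≤` (`leSymb`), an
`L`-structure `M` is *ordered* if the interpretation of `≤` is a (reflexive) linear order
on the vertex set `M`. -/
def IsOrderedStructure (L : FirstOrder.Language) [L.IsOrdered] (M : Type*) [L.Structure M] :
    Prop :=
  IsLinearOrder M (fun x y => RelMap (leSymb : L.Relations 2) ![x, y])

/-- The Erdős–Rado partition arrow `C ⟶ (B)^A_2`: for every 2-colouring `χ` of the embeddings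
of `A` into `C` there is an embedding `f` of `B` into `C` such that `χ` is constant on
`{f ∘ g : g ∈ Emb(A, B)}`. -/
def PartitionArrow (L : FirstOrder.Language) (C B A : Type*)
    [L.Structure C] [L.Structure B] [L.Structure A] : Prop :=
  ∀ χ : (A ↪[L] C) → Fin 2, ∃ f : B ↪[L] C, ∃ c : Fin 2, ∀ g : A ↪[L] B, χ (f.comp g) = c

end StructuralRamsey

/-!
Ramsey's theorem gives `N` such that every colouring of the increasing maps `A → Fin N` is constant
on the maps through one increasing `t : B → Fin N`. Start from a system `P` of copies of `B`, one
lying over each increasing `t : B → Fin N`, and enlarge it by the partite construction, once for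
each injection `s : A → Fin N`, using the Hales–Jewett theorem with the copies of `A` over `s` as
alphabet. In the result every colouring becomes constant on the copies of `A` over any one `s`
inside a suitable copy of `P`, so that it induces a colouring of the maps `s`, to which Ramsey's
theorem applies. Throughout, `≤` is treated as an arbitrary relation; only at the end is it
replaced by a linear order for which the projection to `Fin N` is monotone. The copies of `A` and
`B` lying over increasing maps survive this replacement.
-/

namespace StructuralRamsey

open FirstOrder FirstOrder.Language FirstOrder.Language.Structure
open Combinatorics (Line)

universe u v

section Ramsey

open Finset

variable {α : Type u} {κ : Type v}

/-- The colouring `χ` is constant on the `k`-element subsets of `T`. -/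
def IsMonochromatic (χ : Finset α → κ) (k : ℕ) (T : Finset α) : Prop :=
  ∃ c, ∀ U ⊆ T, #U = k → χ U = c

/-- The colour of a `(k + 1)`-element subset of `T` depends only on its least element, through the
function `d`. This is the intermediate notion in the inductive proof of Ramsey's theorem. -/
def IsMinHomogeneous [LinearOrder α] (χ : Finset α → κ) (k : ℕ) (d : α → κ) (T : Finset α) :
    Prop :=
  ∀ x ∈ T, ∀ U ⊆ T, #U = k → (∀ y ∈ U, x < y) → χ (insert x U) = d x

/-- Every `κ`-colouring of the finite subsets of a type is constant on the `k`-element subsets of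
some `n`-element subset of any given set with at least `N` elements. -/
def IsRamseyNumber (κ : Type v) (k n N : ℕ) : Prop :=
  ∀ {α : Type u} (S : Finset α), N ≤ #S → ∀ χ : Finset α → κ,
    ∃ T ⊆ S, #T = n ∧ IsMonochromatic χ k T

theorem isRamseyNumber_zero (κ : Type v) (n : ℕ) : IsRamseyNumber.{u} κ 0 n n := by
  intro α S hS χ
  obtain ⟨T, hTS, hT⟩ := exists_subset_card_eq hS
  exact ⟨T, hTS, hT, χ ∅, fun U _ hU => congrArg χ (card_eq_zero.1 hU)⟩

variable [LinearOrder α] {χ : Finset α → κ} {k : ℕ} {d : α → κ} {T : Finset α}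

protected theorem IsMinHomogeneous.insert {a : α} {c : κ} (hT : IsMinHomogeneous χ k d T)
    (haT : ∀ y ∈ T, a < y) (hc : ∀ U ⊆ T, #U = k → χ (insert a U) = c) :
    IsMinHomogeneous χ k (Function.update d a c) (insert a T) := by
  intro x hx U hU hUk hxU
  have hax : a ≤ x := by
    rcases mem_insert.1 hx with rfl | hx
    exacts [le_rfl, (haT x hx).le]
  have haU : a ∉ U := fun ha => (hxU a ha).not_ge hax
  have hUT : U ⊆ T := (subset_insert_iff_of_notMem haU).1 hU
  rcases eq_or_ne x a with rfl | hxa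
  · rw [Function.update_self, hc U hUT hUk]
  · rw [Function.update_of_ne hxa, hT x (mem_of_mem_insert_of_ne hx hxa) U hUT hUk hxU]

theorem exists_isMinHomogeneous (hk : ∀ n, ∃ N, IsRamseyNumber.{u} κ k n N) (m : ℕ) :
    ∃ N, ∀ {α : Type u} [LinearOrder α] (S : Finset α), N ≤ #S → ∀ χ : Finset α → κ,
      ∃ T ⊆ S, #T = m ∧ ∃ d, IsMinHomogeneous χ k d T := by
  induction m with
  | zero =>
    exact ⟨0, fun S _ χ => ⟨∅, empty_subset S, rfl, fun _ => χ ∅, by simp [IsMinHomogeneous]⟩⟩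
  | succ m ih =>
    obtain ⟨N₁, hN₁⟩ := ih
    obtain ⟨N₂, hN₂⟩ := hk N₁
    refine ⟨N₂ + 1, fun S hS χ => ?_⟩
    have hne : S.Nonempty := card_pos.1 (by lia)
    set a := S.min' hne
    have haS : a ∈ S := S.min'_mem hne
    obtain ⟨S₁, hS₁, hcard, c, hc⟩ := hN₂ (S.erase a) (by rw [card_erase_of_mem haS]; lia)
      fun U => χ (insert a U)
    obtain ⟨T, hTS₁, hT, d, hd⟩ := hN₁ S₁ hcard.ge χ
    have hTS : T ⊆ S.erase a := hTS₁.trans hS₁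
    have haT : ∀ y ∈ T, a < y := fun y hy => S.min'_lt_of_mem_erase_min' hne (hTS hy)
    refine ⟨insert a T, insert_subset haS (hTS.trans (erase_subset a S)), ?_,
      Function.update d a c, hd.insert haT fun U hU => hc U (hU.trans hTS₁)⟩
    rw [card_insert_of_notMem fun ha => (haT a ha).false, hT]

theorem IsMinHomogeneous.exists_isMonochromatic [Fintype κ] {n : ℕ}
    (hd : IsMinHomogeneous χ k d T) (hT : Fintype.card κ * n ≤ #T) :
    ∃ V ⊆ T, #V = n ∧ IsMonochromatic χ (k + 1) V := by
  classical
  obtain ⟨c, -, hc⟩ := exists_le_card_fiber_of_mul_le_card_of_maps_to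
    (fun x (_ : x ∈ T) => mem_univ (d x)) ⟨χ ∅, mem_univ _⟩ hT
  obtain ⟨V, hV, hVn⟩ := exists_subset_card_eq hc
  have hVT : V ⊆ T := hV.trans (filter_subset _ T)
  refine ⟨V, hVT, hVn, c, fun U hU hUk => ?_⟩
  have hne : U.Nonempty := card_pos.1 (by lia)
  have hmin : U.min' hne ∈ U := U.min'_mem hne
  have hUT : U ⊆ T := hU.trans hVT
  calc χ U = χ (insert (U.min' hne) (U.erase (U.min' hne))) := by rw [insert_erase hmin]
    _ = d (U.min' hne) := hd _ (hUT hmin) _ ((erase_subset _ U).trans hUT)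
        (by rw [card_erase_of_mem hmin, hUk, Nat.add_sub_cancel])
        fun y hy => U.min'_lt_of_mem_erase_min' hne hy
    _ = c := (mem_filter.1 (hV (hU hmin))).2

theorem exists_isRamseyNumber (κ : Type v) [Finite κ] (k n : ℕ) :
    ∃ N, IsRamseyNumber.{u} κ k n N := by
  cases nonempty_fintype κ
  induction k generalizing n with
  | zero => exact ⟨n, isRamseyNumber_zero κ n⟩
  | succ k ih =>
    obtain ⟨N, hN⟩ := exists_isMinHomogeneous ih (Fintype.card κ * n)
    refine ⟨N, fun {α} S hS χ => ?_⟩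
    obtain ⟨_, -⟩ := exists_wellFoundedLT α
    obtain ⟨T, hTS, hT, d, hd⟩ := hN S hS χ
    obtain ⟨V, hVT, hV⟩ := hd.exists_isMonochromatic hT.ge
    exact ⟨V, hVT.trans hTS, hV⟩

theorem exists_orderEmbedding_map_univ_eq (A : Type*) [LinearOrder A] [Fintype A] (U : Finset α)
    (hU : #U = Fintype.card A) : ∃ f : A ↪o α, univ.map f.toEmbedding = U := by
  refine ⟨(Fintype.orderIsoFinOfCardEq A rfl).symm.toOrderEmbedding.trans (U.orderEmbOfFin hU), ?_⟩
  refine eq_of_subset_of_card_le (fun x hx => ?_) (by simp [hU])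
  obtain ⟨a, -, rfl⟩ := mem_map.1 hx
  exact U.orderEmbOfFin_mem hU _

theorem map_univ_orderEmbedding_injective (A : Type*) [LinearOrder A] [Fintype A] :
    Function.Injective fun f : A ↪o α => univ.map f.toEmbedding := by
  intro f g hfg
  refine OrderEmbedding.range_inj.1 ?_
  simpa using congrArg (fun U : Finset α => (U : Set α)) hfg

theorem exists_orderEmbedding_monochromatic (A B : Type*) [LinearOrder A] [LinearOrder B]
    [Finite A] [Finite B] (κ : Type*) [Finite κ] [Nonempty κ] :
    ∃ N : ℕ, ∀ χ : (A ↪o Fin N) → κ, ∃ t : B ↪o Fin N, ∃ c, ∀ g : A ↪o B, χ (g.trans t) = c := by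
  cases nonempty_fintype A
  cases nonempty_fintype B
  obtain ⟨N, hN⟩ := exists_isRamseyNumber κ (Fintype.card A) (Fintype.card B)
  refine ⟨N, fun χ => ?_⟩
  let image (f : A ↪o Fin N) : Finset (Fin N) := univ.map f.toEmbedding
  obtain ⟨T, -, hT, c, hc⟩ := hN (univ : Finset (Fin N)) (by simp)
    (Function.extend image χ fun _ => Classical.arbitrary κ)
  obtain ⟨t, rfl⟩ := exists_orderEmbedding_map_univ_eq B T hT
  refine ⟨t, c, fun g => ?_⟩
  have himage : image (g.trans t) ⊆ univ.map t.toEmbedding := fun x hx => by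
    obtain ⟨a, -, rfl⟩ := mem_map.1 hx
    exact mem_map_of_mem _ (mem_univ (g a))
  rw [← hc _ himage (by simp [image]), (map_univ_orderEmbedding_injective A).extend_apply]

end Ramsey

section PartiteConstruction

variable {L : FirstOrder.Language}

/-- The vertices of the partite construction on a system `P` over `I`: a vertex lies over a vertex
of `I` and has coordinates indexed by `ι` that are either vertices of `P` or undefined. -/
@[ext]
structure PartitePower (I P ι : Type*) where
  base : I
  coord : ι → Option P

namespace PartitePower

variable {A I P ι : Type*}

instance [Finite I] [Finite P] [Finite ι] : Finite (PartitePower I P ι) :=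
  Finite.of_injective (fun x => (x.base, x.coord)) fun _ _ h =>
    PartitePower.ext (congrArg Prod.fst h) (congrArg Prod.snd h)

/-- The tuple `u` of vertices of `P` is the tuple of `i`-th coordinates of `x` for some `i`. -/
def IsCoordinate {n : ℕ} (x : Fin n → PartitePower I P ι) (u : Fin n → P) : Prop :=
  ∃ i, ∀ j, (x j).coord i = some (u j)

variable [L.Structure A] [L.Structure I] [L.Structure P] {π : P → I} {s : A ↪[L] I}

/-- The copies of `A` in the system `π : P → I` lying over `s`. They are the alphabet to which the
Hales–Jewett theorem is applied. -/
abbrev CopyOver (π : P → I) (s : A ↪[L] I) :=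
  {e : A ↪[L] P // π ∘ e = s}

/-- The map to the partite power given by a combinatorial line: its active coordinates are the
identity, and the others send the vertices over the range of `s` to a fixed copy of `A`. -/
noncomputable def lineMap (l : Line (CopyOver π s) ι) (p : P) : PartitePower I P ι where
  base := π p
  coord i := (l.idxFun i).elim (some p) fun e => (Function.partialInv s (π p)).map e.1

theorem lineMap_injective (l : Line (CopyOver π s) ι) : Function.Injective (lineMap l) := by
  obtain ⟨i, hi⟩ := l.proper
  intro p q hpq
  simpa [lineMap, hi] using congrFun (congrArg coord hpq) i

theorem isCoordinate_lineMap (l : Line (CopyOver π s) ι) {n : ℕ} (v : Fin n → P) :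
    IsCoordinate (lineMap l ∘ v) v := by
  obtain ⟨i, hi⟩ := l.proper
  exact ⟨i, fun j => by simp [lineMap, hi]⟩

theorem eq_or_relMap_iff_of_isCoordinate_lineMap (l : Line (CopyOver π s) ι) {n : ℕ}
    (r : L.Relations n) {u v : Fin n → P} (hu : IsCoordinate (lineMap l ∘ v) u) :
    u = v ∨ (RelMap r u ↔ RelMap r (π ∘ v)) := by
  obtain ⟨i, hi⟩ := hu
  simp only [Function.comp_apply, lineMap] at hi
  rcases hl : l.idxFun i with _ | e
  · exact Or.inl <| funext fun j => by simpa [hl, eq_comm] using hi j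
  · have hover (j) : ∃ a, s a = π (v j) ∧ e.1 a = u j := by
      obtain ⟨a, ha, hau⟩ :=
        Option.map_eq_some_iff.1 (by simpa only [hl, Option.elim_some] using hi j)
      exact ⟨a, (s.injective.isPartialInv _ _).1 ha, hau⟩
    choose a ha hau using hover
    obtain rfl : e.1 ∘ a = u := funext hau
    have hsa : s ∘ a = π ∘ v := funext ha
    rw [e.1.map_rel, ← hsa, s.map_rel]
    exact Or.inr Iff.rfl

variable [L.IsRelational]

/-- A relation holds of `x` as it does of the projection of `x` to `I`, unless `x` has a
coordinate on which the relation disagrees with the projection; then it is reversed. Thus copies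
of `A` over an embedding of `A` into `I`, which never disagree, have no effect as coordinates. -/
instance : L.Structure (PartitePower I P ι) where
  funMap f := isEmptyElim f
  RelMap r x := Xor (RelMap r (base ∘ x))
    (∃ u, IsCoordinate x u ∧ Xor (RelMap r u) (RelMap r (base ∘ x)))

theorem relMap_iff {n : ℕ} (r : L.Relations n) (x : Fin n → PartitePower I P ι) :
    RelMap r x ↔ Xor (RelMap r (base ∘ x))
      (∃ u, IsCoordinate x u ∧ Xor (RelMap r u) (RelMap r (base ∘ x))) :=
  Iff.rfl

theorem relMap_iff_base {n : ℕ} (r : L.Relations n) {x : Fin n → PartitePower I P ι}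
    (h : ∀ u, IsCoordinate x u → (RelMap r u ↔ RelMap r (base ∘ x))) :
    RelMap r x ↔ RelMap r (base ∘ x) := by
  have hagree : ¬ ∃ u, IsCoordinate x u ∧ Xor (RelMap r u) (RelMap r (base ∘ x)) := by
    rintro ⟨u, hu, hxor⟩
    exact (xor_iff_not_iff _ _).1 hxor (h u hu)
  rw [relMap_iff, iff_false_intro hagree, xor_comm, xor_false, id]

theorem relMap_iff_coordinate {n : ℕ} (r : L.Relations n) {x : Fin n → PartitePower I P ι}
    {v : Fin n → P} (hv : IsCoordinate x v)
    (h : ∀ u, IsCoordinate x u → u = v ∨ (RelMap r u ↔ RelMap r (base ∘ x))) :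
    RelMap r x ↔ RelMap r v := by
  have hdisagree : (∃ u, IsCoordinate x u ∧ Xor (RelMap r u) (RelMap r (base ∘ x))) ↔
      Xor (RelMap r v) (RelMap r (base ∘ x)) := by
    refine ⟨fun ⟨u, hu, hur⟩ => ?_, fun hvr => ⟨v, hv, hvr⟩⟩
    rcases h u hu with rfl | hiff
    exacts [hur, absurd hiff ((xor_iff_not_iff _ _).1 hur)]
  rw [relMap_iff, hdisagree]
  grind

/-- The copy of `A` in the partite power given by a word of copies of `A` over `s`. -/
def wordEmbedding (w : ι → CopyOver π s) : A ↪[L] PartitePower I P ι where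
  toFun a := ⟨s a, fun i => some ((w i).1 a)⟩
  inj' _ _ h := s.injective (congrArg base h)
  map_fun' f := isEmptyElim f
  map_rel' r v := by
    refine (relMap_iff_base r ?_).trans (s.map_rel r v)
    rintro u ⟨i, hi⟩
    obtain rfl : (w i).1 ∘ v = u := funext fun j => Option.some.inj (hi j)
    exact ((w i).1.map_rel r v).trans (s.map_rel r v).symm

/-- The copy of `P` in the partite power given by a combinatorial line. -/
noncomputable def lineEmbedding (l : Line (CopyOver π s) ι) : P ↪[L] PartitePower I P ι where
  toFun := lineMap l
  inj' := lineMap_injective l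
  map_fun' f := isEmptyElim f
  map_rel' r v := relMap_iff_coordinate r (isCoordinate_lineMap l v) fun _ =>
    eq_or_relMap_iff_of_isCoordinate_lineMap l r

theorem lineEmbedding_comp (l : Line (CopyOver π s) ι) (e : CopyOver π s) :
    (lineEmbedding l).comp e.1 = wordEmbedding (l e) := by
  ext a : 1
  have hea : π (e.1 a) = s a := congrFun e.2 a
  refine PartitePower.ext hea (funext fun i => ?_)
  change (l.idxFun i).elim (some (e.1 a))
    (fun e' => (Function.partialInv s (π (e.1 a))).map e'.1) = some ((l e i).1 a)
  rw [hea, Function.partialInv_left s.injective, Line.coe_apply]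
  rcases l.idxFun i <;> rfl

end PartitePower

/-- The arrow of the partite construction: every colouring of the copies of `A` in the system
`π' : P' → I` is, inside some copy of the system `π : P → I`, constant on the copies of `A` over
each of the transversals `s ∈ T`. -/
def PartiteArrow (L : FirstOrder.Language) {A I P P' : Type*} [L.Structure A] [L.Structure P]
    [L.Structure P'] (κ : Type*) (T : Set (A ↪ I)) (π : P → I) (π' : P' → I) : Prop :=
  ∀ χ : (A ↪[L] P') → κ, ∃ φ : P ↪[L] P', π' ∘ φ = π ∧
    ∀ s ∈ T, ∃ c, ∀ e : A ↪[L] P, π ∘ e = s → χ (φ.comp e) = c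

variable {A : Type*} {I P P₁ P₂ κ : Type*} [L.Structure A] [L.Structure P]
  [L.Structure P₁] [L.Structure P₂]

protected theorem PartiteArrow.insert {s : A ↪ I} {T : Set (A ↪ I)} {π : P → I} {π₁ : P₁ → I}
    {π₂ : P₂ → I} (hs : PartiteArrow L κ {s} π π₁)
    (hT : PartiteArrow L κ T π₁ π₂) : PartiteArrow L κ (insert s T) π π₂ := by
  intro χ
  obtain ⟨ψ, hψ, hψT⟩ := hT χ
  obtain ⟨φ, hφ, hφs⟩ := hs fun e => χ (ψ.comp e)
  refine ⟨ψ.comp φ, by rw [← hφ, ← hψ]; rfl, fun t ht => ?_⟩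
  rcases Set.mem_insert_iff.1 ht with rfl | ht
  · exact hφs t rfl
  · obtain ⟨c, hc⟩ := hψT t ht
    exact ⟨c, fun e he => hc (φ.comp e) (by rw [← he, ← hφ]; rfl)⟩

variable [L.IsRelational]

theorem exists_structure_embedding_eq (s : A ↪ I) :
    ∃ (_ : L.Structure I) (s' : A ↪[L] I), ⇑s' = s := by
  let _ : L.Structure I := ⟨fun f => isEmptyElim f, fun r x => ∃ a, s ∘ a = x ∧ RelMap r a⟩
  refine ⟨‹_›, ⟨s, fun f => isEmptyElim f, fun r a => ?_⟩, rfl⟩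
  refine ⟨fun ⟨b, hb, hr⟩ => ?_, fun hr => ⟨a, rfl, hr⟩⟩
  rwa [← s.injective.comp_left hb]

theorem exists_partiteArrow_singleton {A : Type*} {I : Type v} {P : Type (max u v)} {κ : Type*}
    [L.Structure A] [L.Structure P] [Finite A] [Finite I] [Finite P] [Finite κ] (s : A ↪ I)
    (π : P → I) :
    ∃ (P' : Type (max u v)) (_ : L.Structure P') (_ : Finite P') (π' : P' → I),
      PartiteArrow L κ {s} π π' := by
  obtain ⟨_, s, hs⟩ := exists_structure_embedding_eq (L := L) s
  have : Finite (A ↪[L] P) := DFunLike.finite _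
  obtain ⟨ι, _, hι⟩ := Line.exists_mono_in_high_dimension (PartitePower.CopyOver π s) κ
  refine ⟨PartitePower I P ι, inferInstance, inferInstance, PartitePower.base, fun χ => ?_⟩
  obtain ⟨l, c, hl⟩ := hι fun w => χ (PartitePower.wordEmbedding w)
  refine ⟨PartitePower.lineEmbedding l, rfl, ?_⟩
  rintro _ rfl
  refine ⟨c, fun e he => ?_⟩
  rw [PartitePower.lineEmbedding_comp l ⟨e, he.trans hs.symm⟩]
  exact hl _

theorem exists_partiteArrow {A : Type*} {I : Type v} {κ : Type*} [L.Structure A] [Finite A]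
    [Finite I] [Finite κ] {T : Set (A ↪ I)} (hT : T.Finite) {P : Type (max u v)}
    [L.Structure P] [Finite P] (π : P → I) :
    ∃ (P' : Type (max u v)) (_ : L.Structure P') (_ : Finite P') (π' : P' → I),
      PartiteArrow L κ T π π' := by
  induction T, hT using Set.Finite.induction_on generalizing P with
  | empty => exact ⟨P, ‹_›, ‹_›, π, fun _ => ⟨Embedding.refl L P, rfl, by simp⟩⟩
  | @insert s T _ _ ih =>
    obtain ⟨P₁, _, _, π₁, h₁⟩ := exists_partiteArrow_singleton.{u} (L := L) (κ := κ) s π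
    obtain ⟨P₂, _, _, π₂, h₂⟩ := ih π₁
    exact ⟨P₂, ‹_›, ‹_›, π₂, h₁.insert h₂⟩

end PartiteConstruction

section Ordered

variable {L : FirstOrder.Language} {M : Type*} [L.Structure M]

/-- Copies of `M` indexed by `T`. The relations between different copies are irrelevant for the
partite construction; here all relations are pulled back along the projection to `M`. -/
structure Copies (T M : Type*) where
  index : T
  vertex : M

namespace Copies

variable {T : Type*}

instance [Finite T] [Finite M] : Finite (Copies T M) :=
  Finite.of_injective (fun x => (x.index, x.vertex)) fun ⟨_, _⟩ ⟨_, _⟩ h => by simpa using h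

variable [L.IsRelational]

instance : L.Structure (Copies T M) where
  funMap f := isEmptyElim f
  RelMap r v := RelMap r (vertex ∘ v)

/-- The copy of `M` with index `t`. -/
def embedding (t : T) : M ↪[L] Copies T M where
  toFun := mk t
  inj' _ _ h := congrArg vertex h
  map_fun' f := isEmptyElim f
  map_rel' _ _ := Iff.rfl

end Copies

section Reordered

variable [L.IsOrdered]

/-- The interpretation of the relation symbols on `M` in which `≤` is reinterpreted as the given
order and all other symbols are left unchanged. -/
inductive ReorderedRelMap [LE M] : ∀ {n : ℕ}, L.Relations n → (Fin n → M) → Prop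
  | leSymb {v : Fin 2 → M} : v 0 ≤ v 1 → ReorderedRelMap leSymb v
  | other {n : ℕ} {r : L.Relations n} {v : Fin n → M} :
      (⟨n, r⟩ : Σ n, L.Relations n) ≠ ⟨2, FirstOrder.Language.leSymb⟩ → RelMap r v →
      ReorderedRelMap r v

/-- A type synonym of the ordered type `M`, carrying the structure of `M` with `≤` reinterpreted as
the order. -/
def Reordered (M : Type*) := M

namespace Reordered

instance [Finite M] : Finite (Reordered M) := inferInstanceAs (Finite M)

instance [LinearOrder M] : LinearOrder (Reordered M) := inferInstanceAs (LinearOrder M)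

instance [LE M] : L.Structure (Reordered M) where
  funMap := funMap (M := M)
  RelMap := ReorderedRelMap (M := M)

theorem relMap_leSymb_iff [LE M] (v : Fin 2 → M) :
    RelMap (M := Reordered M) (leSymb : L.Relations 2) v ↔ v 0 ≤ v 1 := by
  refine ⟨fun h => ?_, ReorderedRelMap.leSymb⟩
  cases h with
  | leSymb h => exact h
  | other hne => exact absurd rfl hne

instance [LinearOrder M] : L.OrderedStructure (Reordered M) where
  relMap_leSymb := relMap_leSymb_iff (M := M)

theorem relMap_iff [LE M] {n : ℕ} {r : L.Relations n}
    (hr : (⟨n, r⟩ : Σ n, L.Relations n) ≠ ⟨2, leSymb⟩) {v : Fin n → M} :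
    RelMap (M := Reordered M) r v ↔ RelMap r v := by
  refine ⟨fun h => ?_, ReorderedRelMap.other hr⟩
  cases h with
  | leSymb => exact absurd rfl hr
  | other _ h => exact h

/-- A strictly monotone embedding into `M` remains an embedding after `M` is reordered. -/
def embedding {B : Type*} [LinearOrder B] [L.Structure B] [L.OrderedStructure B] [LinearOrder M]
    (f : B ↪[L] M) (hf : StrictMono f) : B ↪[L] Reordered M where
  toFun := f
  inj' := f.injective
  map_fun' := f.map_fun'
  map_rel' {n} r v := by
    by_cases hr : (⟨n, r⟩ : Σ n, L.Relations n) = ⟨2, leSymb⟩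
    · cases hr
      exact (relMap_leSymb_iff (f ∘ v)).trans (hf.le_iff_le.trans (relMap_leSymb v).symm)
    · exact (relMap_iff (M := M) hr).trans (f.map_rel r v)

end Reordered

end Reordered

theorem exists_linearOrder_monotone {C I : Type*} [LinearOrder I] (π : C → I) :
    ∃ _ : LinearOrder C, Monotone π := by
  obtain ⟨_, -⟩ := exists_wellFoundedLT C
  let key (x : C) : I ×ₗ C := toLex (π x, x)
  have hkey : Function.Injective key := fun x y h => congrArg (fun z => (ofLex z).2) h
  exact ⟨LinearOrder.lift' key hkey, fun x y h => Prod.Lex.monotone_fst _ _ h⟩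

/-- The Erdős–Rado partition arrow `C ⟶ (B)^A_κ` for colourings with values in `κ`; the arrow
`PartitionArrow` is the case of two colours. -/
def PartitionArrowIn (L : FirstOrder.Language) (κ C B A : Type*)
    [L.Structure C] [L.Structure B] [L.Structure A] : Prop :=
  ∀ χ : (A ↪[L] C) → κ, ∃ f : B ↪[L] C, ∃ c : κ, ∀ g : A ↪[L] B, χ (f.comp g) = c

theorem PartitionArrowIn.of_embedding {A B B' C κ : Type*} [L.Structure A] [L.Structure B]
    [L.Structure B'] [L.Structure C] (h : PartitionArrowIn L κ C B' A) (e : B ↪[L] B') :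
    PartitionArrowIn L κ C B A := by
  intro χ
  obtain ⟨f, c, hc⟩ := h χ
  exact ⟨f.comp e, c, fun g => hc (e.comp g)⟩

theorem exists_partitionArrowIn {A : Type*} {B : Type u} {κ : Type*} [L.IsRelational] [L.IsOrdered]
    [LinearOrder A] [L.Structure A] [L.OrderedStructure A] [Finite A]
    [LinearOrder B] [L.Structure B] [L.OrderedStructure B] [Finite B] [Finite κ] [Nonempty κ] :
    ∃ (C : Type u) (_ : LinearOrder C) (_ : L.Structure C),
      Finite C ∧ L.OrderedStructure C ∧ PartitionArrowIn L κ C B A := by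
  obtain ⟨N, hN⟩ := exists_orderEmbedding_monochromatic A B κ
  let π₀ (x : Copies (B ↪o Fin N) B) : Fin N := x.index x.vertex
  have : Finite (B ↪o Fin N) := DFunLike.finite _
  obtain ⟨C, _, _, π, hC⟩ := exists_partiteArrow.{u} (L := L) (κ := κ)
    (Set.finite_univ (α := A ↪ Fin N)) π₀
  obtain ⟨_, hπ⟩ := exists_linearOrder_monotone π
  refine ⟨Reordered C, inferInstance, inferInstance, inferInstance, inferInstance, fun χ => ?_⟩
  let χ' (e : A → C) : κ := Function.extend (fun e : A ↪[L] Reordered C => (e : A → C)) χ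
    (fun _ => Classical.arbitrary κ) e
  obtain ⟨φ, hφ, hc⟩ := hC fun e => χ' e
  choose c hc using fun s => hc s (Set.mem_univ s)
  obtain ⟨t, k, hk⟩ := hN fun s => c s.toEmbedding
  let f : B ↪[L] C := φ.comp (Copies.embedding t)
  have hπf : π ∘ f = t := funext fun b => congrFun hφ ⟨t, b⟩
  have hf : StrictMono f := fun x y hxy => hπ.reflect_lt <| by
    simpa [← hπf] using t.strictMono hxy
  refine ⟨Reordered.embedding f hf, k, fun g => ?_⟩
  let g' : A ↪o B := OrderEmbedding.ofStrictMono g (HomClass.strictMono g)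
  calc χ ((Reordered.embedding f hf).comp g)
    _ = χ' (f.comp g) := (DFunLike.coe_injective.extend_apply χ _ _).symm
    _ = c (g'.trans t).toEmbedding := hc _ ((Copies.embedding t).comp g) rfl
    _ = k := hk g'

variable [L.IsOrdered]

theorem isOrderedStructure_iff :
    IsOrderedStructure L M ↔ ∃ _ : LinearOrder M, L.OrderedStructure M := by
  refine ⟨fun h => ?_, fun ⟨_, _⟩ => ?_⟩
  · let _ : LinearOrder M :=
      { __ := L.leOfStructure M
        le_refl := h.refl
        le_trans := h.trans
        le_antisymm := h.antisymm
        le_total := h.total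
        toDecidableLE := Classical.decRel _ }
    exact ⟨‹_›, inferInstance⟩
  · simpa only [IsOrderedStructure, relMap_leSymb] using inferInstanceAs (IsLinearOrder M (· ≤ ·))

theorem IsOrderedStructure.of_embedding {N : Type*} [L.Structure N] (hN : IsOrderedStructure L N)
    (f : M ↪[L] N) : IsOrderedStructure L M := by
  obtain ⟨_, _⟩ := isOrderedStructure_iff.1 hN
  let _ : LinearOrder M := LinearOrder.lift' f f.injective
  exact isOrderedStructure_iff.2
    ⟨‹_›, ⟨fun x => (f.map_rel leSymb x).symm.trans (relMap_leSymb (f ∘ x))⟩⟩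

end Ordered

theorem mainTheorem8_general (L : FirstOrder.Language) [L.IsRelational] [L.IsOrdered]
    (κ A B : Type*) [L.Structure A] [L.Structure B] [Finite B] [Finite κ] [Nonempty κ]
    (hB : IsOrderedStructure L B) :
    ∃ (C : Type) (_ : L.Structure C), Finite C ∧ IsOrderedStructure L C ∧
      PartitionArrowIn L κ C B A := by
  obtain ⟨n, ⟨e⟩⟩ := Finite.exists_equiv_fin B
  let _ : L.Structure (Fin n) := e.inducedStructure
  let e' : B ≃[L] Fin n := e.inducedStructureEquiv
  have hn : IsOrderedStructure L (Fin n) := hB.of_embedding e'.symm.toEmbedding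
  rcases isEmpty_or_nonempty (A ↪[L] B) with hAB | ⟨⟨i⟩⟩
  · exact ⟨Fin n, ‹_›, inferInstance, hn, fun _ =>
      ⟨e'.toEmbedding, Classical.arbitrary κ, fun g => isEmptyElim g⟩⟩
  have : Finite A := Finite.of_injective i i.injective
  obtain ⟨_, _⟩ := isOrderedStructure_iff.1 (hB.of_embedding i)
  obtain ⟨_, _⟩ := isOrderedStructure_iff.1 hn
  obtain ⟨C, _, _, _, _, hC⟩ := exists_partitionArrowIn (L := L) (A := A) (B := Fin n) (κ := κ)
  exact ⟨C, ‹_›, ‹_›, isOrderedStructure_iff.2 ⟨‹_›, ‹_›⟩, hC.of_embedding e'.toEmbedding⟩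

end StructuralRamsey

theorem mainTheorem8 (L : FirstOrder.Language) [L.IsRelational] [L.IsOrdered]
    (A B : Type*) [L.Structure A] [L.Structure B] [Finite A] [Finite B]
    (hA : StructuralRamsey.IsOrderedStructure L A)
    (hB : StructuralRamsey.IsOrderedStructure L B) :
    ∃ (C : Type) (_ : L.Structure C), Finite C ∧
      StructuralRamsey.IsOrderedStructure L C ∧
      StructuralRamsey.PartitionArrow L C B A :=
  StructuralRamsey.mainTheorem8_general L (Fin 2) A B hB
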